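/- Let $\mathcal X$ and $\mathcal A$ be finite nonempty alphabets and let $B$ be a finite-dimensional quantum system. An assemblage $\hat\rho=\{\hat\rho_B^{a,x}\}_{a\in\mathcal A,x\in\mathcal X}$ is a family of positive semidefinite operators on $B$ such that $\rho_B:=\sum_a\hat\rho_B^{a,x}$ does not depend on $x$ and is a quantum state. It has a local-hidden-state model, written $\hat\rho\in\operatorname{LHS}$, if $\hat\rho_B^{a,x}=\sum_\lambda p_\Lambda(\lambda)\,p_{\overline A|X\Lambda}(a|x,\lambda)\,\rho_B^\lambda$ for all $a,x$, with a probability distribution $p_\Lambda$ on a finite set, conditional probability distributions $p_{\overline A|X\Lambda}$ and quantum states $\rho_B^\lambda$. A 1W-LOCC operation $\{p_{X|Y},\{\mathcal K_y\}_y\}$ consists of a finite family of completely positive trace-non-increasing maps $\mathcal K_y$ from $B$ to a finite-dimensional system $B'$ such that $\sum_y\mathcal K_y$ is trace preserving, and of a conditional probability distribution $p_{X|Y}(x|y)$ on $\mathcal X$. It maps $\hat\rho$ to the state $$\rho_{X\overline AB'Y}:=\sum_{x,a,y}p_{X|Y}(x|y)\,|x\rangle\langle x|_X\otimes|a\rangle\langle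 a|_{\overline A}\otimes\mathcal K_y(\hat\rho_B^{a,x})\otimes|y\rangle\langle y|_Y .$$ The quantum relative entropy is $D(\omega\Vert\tau):=\operatorname{Tr}(\omega[\log_2\omega-\log_2\tau])$ (logarithms taken on the supports) if $\operatorname{supp}\omega\subseteq\operatorname{supp}\tau$, and $+\infty$ otherwise. The relative entropy of steering is $$R_S(\overline A;B)_{\hat\rho}:=\sup_{\{p_{X|Y},\{\mathcal K_y\}_y\}}\ \inf_{\hat\sigma\in\operatorname{LHS}}D(\rho_{X\overline AB'Y}\Vert\sigma_{X\overline AB'Y})\in[0,+\infty],$$ where $\sigma_{X\overline AB'Y}$ arises from $\hat\sigma$ in the same way as $\rho_{X\overline AB'Y}$ from $\hat\rho$. Proposition (faithfulness, converse direction). For every assemblage $\hat\rho=\{\hat\rho_B^{a,x}\}_{a,x}$, $$\sqrt{2\ln 2\;R_S(\overline A;B)_{\hat\rho}}\ \ge\ \inf_{\hat\sigma\in\operatorname{LHS}}\frac1{|\mathcal X|}\sum_{x,a}\left\Vert\hat\rho_B^{a,x}-\hat\sigma_B^{a,x}\right\Vert_1 ,$$ where $\Vert M\Vert_1=\operatorname{Tr}\sqrt{M^\dagger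 M}$. In particular, if $R_S(\overline A;B)_{\hat\rho}=0$, then $\hat\rho\in\operatorname{LHS}$. -/

import Mathlib

open scoped ComplexOrder Kronecker ENNReal

namespace Steering

noncomputable section

/-- A quantum state (density operator) on a finite-dimensional system. -/
def IsState {n : Type*} [Fintype n] (ρ : Matrix n n ℂ) : Prop :=
  ρ.PosSemidef ∧ ρ.trace = 1

/-- The trace norm `‖M‖₁ = Tr √(Mᴴ M)`. -/
def traceNorm {n : Type*} [Fintype n] [DecidableEq n] (M : Matrix n n ℂ) : ℝ :=
  (cfc Real.sqrt (M.conjTranspose * M)).trace.re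

/-- The support of a Hermitian matrix: the orthogonal complement of its kernel,
that is, its range. -/
def supp {n : Type*} [Fintype n] (M : Matrix n n ℂ) : Submodule ℂ (n → ℂ) :=
  LinearMap.range M.mulVecLin

/-- The base-two operator logarithm of a Hermitian matrix, taken on its support:
since `Real.logb 2 0 = 0`, it vanishes on the kernel. -/
def log2 {n : Type*} [Fintype n] [DecidableEq n] (M : Matrix n n ℂ) : Matrix n n ℂ :=
  cfc (Real.logb 2) M

open Classical in
/-- The quantum relative entropy `D(ρ‖σ) = Tr(ρ [log₂ ρ - log₂ σ])` if the support of `ρ` is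
contained in the support of `σ`, and `+∞` otherwise. -/
def relEntropy {n : Type*} [Fintype n] [DecidableEq n] (ρ σ : Matrix n n ℂ) : EReal :=
  if supp ρ ≤ supp σ then (((ρ * (log2 ρ - log2 σ)).trace.re : ℝ) : EReal) else ⊤

/-- An assemblage `{ρ̂^{a,x}}` on Bob's system `B` with input alphabet `X` and output
alphabet `A`: positive semidefinite operators that satisfy the no-signaling principle and whose
sum over the outputs is a quantum state. -/
@[ext]
structure Assemblage (X A B : Type*) [Fintype A] [Fintype B] where
  op : A → X → Matrix B B ℂ
  posSemidef : ∀ a x, (op a x).PosSemidef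
  noSignaling : ∀ x x', ∑ a, op a x = ∑ a, op a x'
  isState : ∀ x, IsState (∑ a, op a x)

/-- The set of assemblages with a local-hidden-state model
`ρ̂^{a,x} = ∑_l p(l) q(a|x,l) τ^l`. -/
def LHS (X A B : Type*) [Fintype A] [Fintype B] : Set (Assemblage X A B) :=
  {ρ | ∃ (n : ℕ) (p : Fin n → ℝ) (q : Fin n → X → A → ℝ) (τ : Fin n → Matrix B B ℂ),
    p ∈ stdSimplex ℝ (Fin n) ∧
    (∀ l x, q l x ∈ stdSimplex ℝ A) ∧
    (∀ l, IsState (τ l)) ∧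
    ∀ a x, ρ.op a x = ∑ l, ((p l * q l x a : ℝ) : ℂ) • τ l}

/-- The map `id_k ⊗ Φ`, acting blockwise on `k × k` block matrices. -/
def ampliation {m n : Type*} (Φ : Matrix m m ℂ →ₗ[ℂ] Matrix n n ℂ) (k : ℕ)
    (M : Matrix (Fin k × m) (Fin k × m) ℂ) : Matrix (Fin k × n) (Fin k × n) ℂ :=
  Matrix.of fun r s => Φ (Matrix.of fun i j => M (r.1, i) (s.1, j)) r.2 s.2

/-- Complete positivity: every `id_k ⊗ Φ` preserves positive semidefiniteness. -/
def IsCompletelyPositive {m n : Type*} (Φ : Matrix m m ℂ →ₗ[ℂ] Matrix n n ℂ) : Prop :=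
  ∀ (k : ℕ) (M : Matrix (Fin k × m) (Fin k × m) ℂ), M.PosSemidef → (ampliation Φ k M).PosSemidef

/-- A 1W-LOCC operation `{p_{X|Y}, {K_y}_y}`: Bob applies a generalized measurement with outcomes
`y` and output system `B'` of dimension `dimB'`, and communicates `y` to Alice, who chooses her
input `x` with probability `p(x|y)`. -/
structure OneWayLOCC (X B : Type*) [Fintype X] [Fintype B] where
  /-- The number of outcomes `y`. -/
  cardY : ℕ
  /-- The dimension of the output system. -/
  dimB' : ℕ
  p : Fin cardY → X → ℝ
  p_mem : ∀ y, p y ∈ stdSimplex ℝ X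
  K : Fin cardY → Matrix B B ℂ →ₗ[ℂ] Matrix (Fin dimB') (Fin dimB') ℂ
  completelyPositive : ∀ y, IsCompletelyPositive (K y)
  traceNonincreasing : ∀ y (M : Matrix B B ℂ), M.PosSemidef → (K y M).trace.re ≤ M.trace.re
  tracePreserving : ∀ M : Matrix B B ℂ, (∑ y, K y M).trace = M.trace

/-- The state `∑_{x,a,y} p(x|y) |x⟩⟨x| ⊗ |a⟩⟨a| ⊗ K_y(ρ̂^{a,x}) ⊗ |y⟩⟨y|`. -/
def OneWayLOCC.outputState {X A B : Type*} [Fintype X] [DecidableEq X] [Fintype A] [DecidableEq A]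
    [Fintype B] (L : OneWayLOCC X B) (ρ : Assemblage X A B) :
    Matrix (X × A × Fin L.dimB' × Fin L.cardY) (X × A × Fin L.dimB' × Fin L.cardY) ℂ :=
  ∑ x, ∑ a, ∑ y, (L.p y x : ℂ) •
    (Matrix.single x x (1 : ℂ) ⊗ₖ (Matrix.single a a (1 : ℂ) ⊗ₖ
      (L.K y (ρ.op a x) ⊗ₖ Matrix.single y y (1 : ℂ))))

/-- The relative entropy of steering: the supremum over 1W-LOCC operations of the infimum over
assemblages with a local-hidden-state model of the relative entropy of the output states. -/
def relEntropySteering {X A B : Type*} [Fintype X] [DecidableEq X] [Fintype A] [DecidableEq A]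
    [Fintype B] (ρ : Assemblage X A B) : EReal :=
  ⨆ L : OneWayLOCC X B, ⨅ σ ∈ LHS X A B, relEntropy (L.outputState ρ) (L.outputState σ)

end

end Steering

/-! The supremum over operations is bounded below by a single one, `uniformLOCC`. Its output states
are block diagonal with blocks `ρ.op a x / |X|`, so their trace distance is the averaged distance of
the assemblages, and the bound becomes Pinsker's inequality, taken to the infimum over `LHS`.

Pinsker is proved directly (`sq_norm_trace_mul_sub_le`). With eigenvalues `r i` of `M`, `s j` of `N`
and overlaps `O` of the eigenbases, the relative entropy is a sum of scalar divergences weighted by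
`‖O i j‖ ^ 2`, while the trace of `U * (M - N)` is a sum over the same pairs of terms `P j i * (r i
- s j) * O i j` with `P` unitary. The scalar bound `Real.pinsker_scalar` and Cauchy–Schwarz compare
the two.

If the steering entropy vanishes, `ρ` is a limit of members of `LHS`. These form the convex hull of
a compact set in finite dimension, which is closed. -/

/-! ### Scalar Pinsker inequality. -/

namespace Real

/-- The rational lower bound on the logarithm behind Pinsker's inequality. -/
theorem pinsker_log_bound {t : ℝ} (ht : 0 < t) :
    3 / 2 * (t - 1) ^ 2 ≤ (t * log t - t + 1) * (t + 2) := by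
  -- This is the difference of the two sides divided by `t * (t + 2)`. The derivative has the sign
  -- of `t - 1`, so the minimum is `h 1 = 0`.
  set h : ℝ → ℝ := fun t => log t - (5 * t ^ 2 - 4 * t - 1) / (2 * t ^ 2 + 4 * t) with hh
  have hd : ∀ t : ℝ, 0 < t → HasDerivAt h ((t - 1) ^ 3 / (t ^ 2 * (t + 2) ^ 2)) t := by
    intro t ht
    have hne : 2 * t ^ 2 + 4 * t ≠ 0 := by positivity
    have h1 : HasDerivAt (fun t : ℝ => 5 * t ^ 2 - 4 * t - 1) (10 * t - 4) t := by
      have := ((((hasDerivAt_id t).pow 2).const_mul 5).sub ((hasDerivAt_id t).const_mul 4)).sub_const 1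
      refine this.congr_deriv ?_
      simp; ring
    have h2 : HasDerivAt (fun t : ℝ => 2 * t ^ 2 + 4 * t) (4 * t + 4) t := by
      have := (((hasDerivAt_id t).pow 2).const_mul 2).add ((hasDerivAt_id t).const_mul 4)
      refine this.congr_deriv ?_
      simp; ring
    refine ((hasDerivAt_log ht.ne').sub (h1.div h2 hne)).congr_deriv ?_
    have : t + 2 ≠ 0 := by positivity
    field_simp
    ring
  have hcont : ContinuousOn h (Set.Ioi 0) := fun t ht => (hd t ht).continuousAt.continuousWithinAt
  have h1 : h 1 = 0 := by simp [hh]; norm_num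
  have hpos : 0 ≤ h t := by
    rcases le_total t 1 with h' | h'
    · have hanti : AntitoneOn h (Set.Icc t 1) := by
        refine antitoneOn_of_deriv_nonpos (convex_Icc t 1)
          (hcont.mono fun x hx => lt_of_lt_of_le ht hx.1) ?_ ?_
        · intro x hx
          rw [interior_Icc] at hx
          exact (hd x (ht.trans hx.1)).differentiableAt.differentiableWithinAt
        · intro x hx
          rw [interior_Icc] at hx
          rw [(hd x (ht.trans hx.1)).deriv]
          exact div_nonpos_of_nonpos_of_nonneg
            ((Odd.pow_nonpos_iff (by decide)).2 (by linarith [hx.2])) (by positivity)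
      have := hanti (Set.left_mem_Icc.2 h') (Set.right_mem_Icc.2 h') h'
      linarith
    · have hmono : MonotoneOn h (Set.Icc 1 t) := by
        refine monotoneOn_of_deriv_nonneg (convex_Icc 1 t)
          (hcont.mono fun x hx => lt_of_lt_of_le one_pos hx.1) ?_ ?_
        · intro x hx
          rw [interior_Icc] at hx
          exact (hd x (one_pos.trans hx.1)).differentiableAt.differentiableWithinAt
        · intro x hx
          rw [interior_Icc] at hx
          rw [(hd x (one_pos.trans hx.1)).deriv]
          have : 0 ≤ x - 1 := by linarith [hx.1]
          positivity
      have := hmono (Set.left_mem_Icc.2 h') (Set.right_mem_Icc.2 h') h'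
      linarith
  have key : (t * log t - t + 1) * (t + 2) - 3 / 2 * (t - 1) ^ 2 = t * (t + 2) * h t := by
    have : t + 2 ≠ 0 := by positivity
    have e : (5 * t ^ 2 - 4 * t - 1) / (2 * t ^ 2 + 4 * t)
        = (5 * t ^ 2 - 4 * t - 1) / (2 * (t * (t + 2))) := by congr 1; ring
    simp only [hh, e]
    field_simp
    ring
  have : 0 ≤ t * (t + 2) * h t := by positivity
  linarith

/-- The scalar Pinsker bound for nonnegative reals, with `s` not vanishing. -/
theorem pinsker_scalar {r s : ℝ} (hr : 0 ≤ r) (hs : 0 < s) :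
    3 / 2 * (r - s) ^ 2 ≤ (r * (log r - log s) - r + s) * (r + 2 * s) := by
  rcases hr.eq_or_lt with rfl | hr
  · simp
    nlinarith [sq_nonneg s]
  · have h := pinsker_log_bound (div_pos hr hs)
    rw [log_div hr.ne' hs.ne'] at h
    have h2 := mul_le_mul_of_nonneg_left h (sq_nonneg s)
    have e1 : s ^ 2 * (3 / 2 * (r / s - 1) ^ 2) = 3 / 2 * (r - s) ^ 2 := by field_simp
    have e2 : s ^ 2 * ((r / s * (log r - log s) - r / s + 1) * (r / s + 2))
        = (r * (log r - log s) - r + s) * (r + 2 * s) := by field_simp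
    linarith

end Real

/-! ### Traces expressed in a pair of eigenbases. -/

namespace Matrix

variable {n : Type*} [Fintype n] [DecidableEq n]

open scoped ComplexConjugate

theorem IsHermitian.cfc_eq_mul {M : Matrix n n ℂ} (hM : M.IsHermitian) (f : ℝ → ℝ) :
    cfc f M = (hM.eigenvectorUnitary : Matrix n n ℂ) *
      diagonal (fun i => ((f (hM.eigenvalues i) : ℝ) : ℂ)) *
      (hM.eigenvectorUnitary : Matrix n n ℂ)ᴴ := by
  rw [hM.cfc_eq, IsHermitian.cfc, Unitary.conjStarAlgAut_apply]
  rfl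

theorem IsHermitian.eq_mul {M : Matrix n n ℂ} (hM : M.IsHermitian) :
    M = (hM.eigenvectorUnitary : Matrix n n ℂ) *
      diagonal (fun i => ((hM.eigenvalues i : ℝ) : ℂ)) *
      (hM.eigenvectorUnitary : Matrix n n ℂ)ᴴ := by
  have := hM.cfc_eq_mul (fun x => x)
  rwa [cfc_id' ℝ M hM.isSelfAdjoint] at this

theorem IsHermitian.conjTranspose_eigenvectorUnitary_mul {M : Matrix n n ℂ} (hM : M.IsHermitian) :
    (hM.eigenvectorUnitary : Matrix n n ℂ)ᴴ * (hM.eigenvectorUnitary : Matrix n n ℂ) = 1 :=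
  Unitary.coe_star_mul_self hM.eigenvectorUnitary

theorem IsHermitian.eigenvectorUnitary_mul_conjTranspose {M : Matrix n n ℂ} (hM : M.IsHermitian) :
    (hM.eigenvectorUnitary : Matrix n n ℂ) * (hM.eigenvectorUnitary : Matrix n n ℂ)ᴴ = 1 :=
  Unitary.coe_mul_star_self hM.eigenvectorUnitary

/-- The overlaps between the eigenvectors of two Hermitian matrices. -/
noncomputable def overlap {M N : Matrix n n ℂ} (hM : M.IsHermitian) (hN : N.IsHermitian) :
    Matrix n n ℂ :=
  (hM.eigenvectorUnitary : Matrix n n ℂ)ᴴ * (hN.eigenvectorUnitary : Matrix n n ℂ)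

theorem overlap_mul_conjTranspose {M N : Matrix n n ℂ} (hM : M.IsHermitian) (hN : N.IsHermitian) :
    overlap hM hN * (overlap hM hN)ᴴ = 1 := by
  rw [overlap, conjTranspose_mul, conjTranspose_conjTranspose, Matrix.mul_assoc,
    ← Matrix.mul_assoc _ _ (hM.eigenvectorUnitary : Matrix n n ℂ),
    hN.eigenvectorUnitary_mul_conjTranspose, Matrix.one_mul,
    hM.conjTranspose_eigenvectorUnitary_mul]

theorem sum_normSq_row_of_mul_conjTranspose {U : Matrix n n ℂ} (hU : U * Uᴴ = 1) (i : n) :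
    ∑ j, ‖U i j‖ ^ 2 = 1 := by
  have h := congrFun (congrFun hU i) i
  rw [mul_apply, one_apply_eq] at h
  simp only [conjTranspose_apply, RCLike.star_def, Complex.mul_conj'] at h
  exact_mod_cast h

theorem sum_normSq_col_of_mul_conjTranspose {U : Matrix n n ℂ} (hU : U * Uᴴ = 1) (j : n) :
    ∑ i, ‖U i j‖ ^ 2 = 1 := by
  have h' : Uᴴ * U = 1 := mul_eq_one_comm.1 hU
  have h := congrFun (congrFun h' j) j
  rw [mul_apply, one_apply_eq] at h
  simp only [conjTranspose_apply, RCLike.star_def, Complex.conj_mul'] at h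
  exact_mod_cast h

theorem trace_cfc {M : Matrix n n ℂ} (hM : M.IsHermitian) (f : ℝ → ℝ) :
    (cfc f M).trace.re = ∑ i, f (hM.eigenvalues i) := by
  rw [hM.cfc_eq_mul, trace_mul_comm, ← Matrix.mul_assoc, hM.conjTranspose_eigenvectorUnitary_mul,
    Matrix.one_mul, trace_diagonal]
  simp

/-- The weights `‖overlap hM hN i j‖ ^ 2` are doubly stochastic, so a trace involving two
noncommuting matrices becomes a classical expectation over pairs of eigenvalues. -/
theorem trace_cfc_mul_cfc {M N : Matrix n n ℂ} (hM : M.IsHermitian) (hN : N.IsHermitian)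
    (f g : ℝ → ℝ) :
    (cfc f M * cfc g N).trace.re =
      ∑ i, ∑ j, ‖overlap hM hN i j‖ ^ 2 * (f (hM.eigenvalues i) * g (hN.eigenvalues j)) := by
  have e : (cfc f M * cfc g N).trace =
      (diagonal (fun i => ((f (hM.eigenvalues i) : ℝ) : ℂ)) * overlap hM hN *
        (diagonal (fun i => ((g (hN.eigenvalues i) : ℝ) : ℂ)) * (overlap hM hN)ᴴ)).trace := by
    rw [hM.cfc_eq_mul, hN.cfc_eq_mul, overlap, conjTranspose_mul, conjTranspose_conjTranspose]
    simp only [Matrix.mul_assoc]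
    rw [trace_mul_comm]
    simp only [Matrix.mul_assoc]
  rw [e, trace]
  simp only [diag_apply, mul_apply (M := _ * _), diagonal_mul, conjTranspose_apply,
    RCLike.star_def, Complex.re_sum]
  refine Finset.sum_congr rfl fun i _ => Finset.sum_congr rfl fun j _ => ?_
  have : ∀ z : ℂ, ∀ a b : ℝ, (a : ℂ) * z * (b * conj z) = ((‖z‖ ^ 2 * (a * b) : ℝ) : ℂ) := by
    intro z a b
    push_cast
    rw [← Complex.mul_conj']
    ring
  rw [this, Complex.ofReal_re]

/-- With the eigenbasis of `M` on the left and that of `N` on the right, `M - N` has entries `(r i -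
s j) * O i j`; only `U` then needs the change of bases. -/
theorem trace_mul_sub {M N : Matrix n n ℂ} (hM : M.IsHermitian) (hN : N.IsHermitian)
    (U : Matrix n n ℂ) :
    (U * (M - N)).trace = ∑ i, ∑ j,
      ((hN.eigenvectorUnitary : Matrix n n ℂ)ᴴ * U * (hM.eigenvectorUnitary : Matrix n n ℂ)) j i *
        ((hM.eigenvalues i - hN.eigenvalues j : ℝ) : ℂ) * overlap hM hN i j := by
  set V := (hM.eigenvectorUnitary : Matrix n n ℂ) with hV
  set W := (hN.eigenvectorUnitary : Matrix n n ℂ) with hW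
  set R : Matrix n n ℂ := diagonal (fun i => ((hM.eigenvalues i : ℝ) : ℂ)) with hR
  set S : Matrix n n ℂ := diagonal (fun i => ((hN.eigenvalues i : ℝ) : ℂ)) with hS
  have hWW : W * Wᴴ = 1 := hN.eigenvectorUnitary_mul_conjTranspose
  have hVV : V * Vᴴ = 1 := hM.eigenvectorUnitary_mul_conjTranspose
  have hMe : M = V * R * Vᴴ := hM.eq_mul
  have hNe : N = W * S * Wᴴ := hN.eq_mul
  have e1 : (U * M).trace = (Wᴴ * U * V * R * overlap hM hN).trace := by
    have : Wᴴ * U * V * R * overlap hM hN = Wᴴ * (U * (V * R * Vᴴ) * W) := by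
      simp only [overlap, Matrix.mul_assoc, V, W]
    rw [this, ← hMe, trace_mul_comm Wᴴ, Matrix.mul_assoc, hWW, Matrix.mul_one]
  have e2 : (U * N).trace = (Wᴴ * U * V * overlap hM hN * S).trace := by
    have : Wᴴ * U * V * overlap hM hN * S = Wᴴ * (U * (V * Vᴴ) * W * S) := by
      simp only [overlap, Matrix.mul_assoc, V, W]
    rw [this, hVV, Matrix.mul_one, trace_mul_comm Wᴴ, Matrix.mul_assoc, Matrix.mul_assoc,
      ← Matrix.mul_assoc W, ← hNe]
  rw [Matrix.mul_sub, trace_sub, e1, e2, trace, trace, ← Finset.sum_sub_distrib,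
    Finset.sum_comm]
  refine Finset.sum_congr rfl fun j _ => ?_
  simp only [diag_apply]
  rw [mul_diagonal, mul_apply, mul_apply, Finset.sum_mul, ← Finset.sum_sub_distrib]
  refine Finset.sum_congr rfl fun i _ => ?_
  rw [mul_diagonal]
  push_cast
  ring

end Matrix

/-! ### Quantum Pinsker inequality and the trace norm. -/

namespace Steering

open Matrix

variable {n : Type*} [Fintype n] [DecidableEq n]

theorem re_trace_eq_sum_eigenvalues {M : Matrix n n ℂ} (hM : M.IsHermitian) :
    M.trace.re = ∑ i, hM.eigenvalues i := by
  rw [hM.trace_eq_sum_eigenvalues, Complex.re_sum]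
  exact Finset.sum_congr rfl fun i _ => Complex.ofReal_re _

theorem cfc_sqrt_conjTranspose_mul_self {M : Matrix n n ℂ} (hM : M.IsHermitian) :
    cfc Real.sqrt (Mᴴ * M) = cfc (fun x : ℝ => |x|) M := by
  have hc : ∀ (f : ℝ → ℝ), ContinuousOn f (spectrum ℝ M) := fun f =>
    M.finite_real_spectrum.continuousOn f
  have e : Mᴴ * M = cfc (fun x : ℝ => x * x) M := by
    rw [cfc_mul (fun x : ℝ => x) (fun x : ℝ => x) M (hc _) (hc _), cfc_id' ℝ M hM.isSelfAdjoint,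
      hM.eq]
  rw [e, ← cfc_comp' Real.sqrt (fun x : ℝ => x * x) M
      Real.continuous_sqrt.continuousOn (hc _) hM.isSelfAdjoint]
  simp only [Real.sqrt_mul_self_eq_abs]

/-- If the support of `M` lies in that of `N`, eigenvectors of `M` with nonzero eigenvalue are
orthogonal to the kernel of `N`. -/
theorem overlap_eq_zero_of_supp_le {M N : Matrix n n ℂ} (hM : M.IsHermitian) (hN : N.IsHermitian)
    (h : supp M ≤ supp N) {i j : n} (hi : hM.eigenvalues i ≠ 0) (hj : hN.eigenvalues j = 0) :
    overlap hM hN i j = 0 := by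
  set v : n → ℂ := ⇑(hM.eigenvectorBasis i) with hv
  set w : n → ℂ := ⇑(hN.eigenvectorBasis j) with hw
  have hMv : M *ᵥ v = hM.eigenvalues i • v := hM.mulVec_eigenvectorBasis i
  have hNw : N *ᵥ w = 0 := by
    rw [hw, hN.mulVec_eigenvectorBasis j, hj, zero_smul]
  have hmem : v ∈ supp N := by
    refine h ⟨(hM.eigenvalues i)⁻¹ • v, ?_⟩
    rw [mulVecLin_apply, mulVec_smul, hMv, smul_smul, inv_mul_cancel₀ hi, one_smul]
  obtain ⟨u, hu⟩ := hmem
  rw [mulVecLin_apply] at hu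
  have e : overlap hM hN i j = star v ⬝ᵥ w := by
    rw [overlap, mul_apply, dotProduct]
    simp only [conjTranspose_apply, IsHermitian.eigenvectorUnitary_apply, Pi.star_apply, v, w]
  rw [e, ← hu, star_mulVec, ← dotProduct_mulVec, hN.eq, hNw, dotProduct_zero]

/-- The relative entropy in terms of the spectral data of its arguments. -/
theorem log_two_mul_trace_mul_log2_sub {M N : Matrix n n ℂ} (hM : M.IsHermitian)
    (hN : N.IsHermitian) :
    Real.log 2 * (M * (log2 M - log2 N)).trace.re =
      ∑ i, ∑ j, ‖overlap hM hN i j‖ ^ 2 * (hM.eigenvalues i *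
        (Real.log (hM.eigenvalues i) - Real.log (hN.eigenvalues j))) := by
  have hc : ∀ (f : ℝ → ℝ), ContinuousOn f (spectrum ℝ M) := fun f =>
    M.finite_real_spectrum.continuousOn f
  -- The identity is written as a function of `N`, so that both traces become sums over the same
  -- pairs with the same weights.
  have e1 : M * log2 M = cfc (fun x : ℝ => x * Real.logb 2 x) M * cfc (fun _ => (1 : ℝ)) N := by
    rw [cfc_const_one ℝ N hN.isSelfAdjoint, Matrix.mul_one,
      cfc_mul (fun x : ℝ => x) (Real.logb 2) M (hc _) (hc _), cfc_id' ℝ M hM.isSelfAdjoint, log2]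
  have e2 : M * log2 N = cfc (fun x : ℝ => x) M * cfc (Real.logb 2) N := by
    rw [cfc_id' ℝ M hM.isSelfAdjoint, log2]
  have hl : Real.log 2 ≠ 0 := (Real.log_pos one_lt_two).ne'
  rw [Matrix.mul_sub, trace_sub, Complex.sub_re, e1, e2, trace_cfc_mul_cfc hM hN,
    trace_cfc_mul_cfc hM hN, ← Finset.sum_sub_distrib, Finset.mul_sum]
  refine Finset.sum_congr rfl fun i _ => ?_
  rw [← Finset.sum_sub_distrib, Finset.mul_sum]
  refine Finset.sum_congr rfl fun j _ => ?_
  simp only [Real.logb]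
  field_simp

/-- The inequality behind the quantum Pinsker inequality: the gap of two states tested against a
unitary is controlled by their relative entropy. -/
theorem sq_norm_trace_mul_sub_le {M N : Matrix n n ℂ} (hM : IsState M) (hN : IsState N)
    (h : supp M ≤ supp N) {U : Matrix n n ℂ} (hU : U * Uᴴ = 1) :
    ‖(U * (M - N)).trace‖ ^ 2 ≤ 2 * Real.log 2 * (M * (log2 M - log2 N)).trace.re := by
  have hMh := hM.1.isHermitian
  have hNh := hN.1.isHermitian
  set r := hMh.eigenvalues with hr
  set s := hNh.eigenvalues with hs
  have hr0 : ∀ i, 0 ≤ r i := hM.1.eigenvalues_nonneg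
  have hs0 : ∀ i, 0 ≤ s i := hN.1.eigenvalues_nonneg
  have hr1 : ∑ i, r i = 1 := by
    rw [hr, ← re_trace_eq_sum_eigenvalues, hM.2, Complex.one_re]
  have hs1 : ∑ i, s i = 1 := by
    rw [hs, ← re_trace_eq_sum_eigenvalues, hN.2, Complex.one_re]
  set O := overlap hMh hNh with hO
  set P := (hNh.eigenvectorUnitary : Matrix n n ℂ)ᴴ * U *
    (hMh.eigenvectorUnitary : Matrix n n ℂ) with hP
  have hOu : O * Oᴴ = 1 := overlap_mul_conjTranspose hMh hNh
  have hPu : P * Pᴴ = 1 := by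
    have h1 := hMh.eigenvectorUnitary_mul_conjTranspose
    have h2 := hNh.conjTranspose_eigenvectorUnitary_mul
    rw [hP, conjTranspose_mul, conjTranspose_mul, conjTranspose_conjTranspose]
    calc _ = (hNh.eigenvectorUnitary : Matrix n n ℂ)ᴴ * (U * ((hMh.eigenvectorUnitary :
        Matrix n n ℂ) * (hMh.eigenvectorUnitary : Matrix n n ℂ)ᴴ) * Uᴴ) *
        (hNh.eigenvectorUnitary : Matrix n n ℂ) := by simp only [Matrix.mul_assoc]
      _ = 1 := by rw [h1, Matrix.mul_one, hU, Matrix.mul_one, h2]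
  have hsum : ∀ (Q : n → n → ℝ) (a b : ℝ), (∀ i, ∑ j, Q i j = 1) → (∀ j, ∑ i, Q i j = 1) →
      ∑ i, ∑ j, Q i j * (a * r i + b * s j) = a + b := by
    intro Q a b h1 h2
    simp only [mul_add, Finset.sum_add_distrib]
    rw [Finset.sum_comm (f := fun i j => Q i j * (b * s j))]
    simp only [← Finset.sum_mul, h1, h2, one_mul, ← Finset.mul_sum, hr1, hs1, mul_one]
  -- The added terms `- r i + s j` sum to zero because both traces are one; they make every summand
  -- nonnegative.
  have hD : Real.log 2 * (M * (log2 M - log2 N)).trace.re =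
      ∑ i, ∑ j, ‖O i j‖ ^ 2 * (r i * (Real.log (r i) - Real.log (s j)) - r i + s j) := by
    have h0 := hsum (fun i j => ‖O i j‖ ^ 2) (-1) 1
      (fun i => sum_normSq_row_of_mul_conjTranspose hOu i)
      (fun j => sum_normSq_col_of_mul_conjTranspose hOu j)
    rw [log_two_mul_trace_mul_log2_sub hMh hNh]
    have : ∀ x : ℝ, x = x + ((-1) + 1) := by intro x; ring
    rw [this (∑ i, _), ← h0, ← Finset.sum_add_distrib]
    refine Finset.sum_congr rfl fun i _ => ?_
    rw [← Finset.sum_add_distrib]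
    refine Finset.sum_congr rfl fun j _ => ?_
    ring
  have hT : ‖(U * (M - N)).trace‖ ≤ ∑ p : n × n, ‖P p.2 p.1‖ * |r p.1 - s p.2| * ‖O p.1 p.2‖ := by
    rw [trace_mul_sub hMh hNh, Fintype.sum_prod_type]
    refine (norm_sum_le _ _).trans (Finset.sum_le_sum fun i _ => (norm_sum_le _ _).trans
      (Finset.sum_le_sum fun j _ => ?_))
    rw [norm_mul, norm_mul, Complex.norm_real, Real.norm_eq_abs]
  have hterm : ∀ i j, 0 ≤ ‖O i j‖ ^ 2 * (r i * (Real.log (r i) - Real.log (s j)) - r i + s j) ∧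
      (‖P j i‖ * |r i - s j| * ‖O i j‖) ^ 2 ≤
      (2 / 3 * (‖O i j‖ ^ 2 * (r i * (Real.log (r i) - Real.log (s j)) - r i + s j))) *
        (‖P j i‖ ^ 2 * (1 * r i + 2 * s j)) := by
    intro i j
    -- For `s j = 0` the scalar bound is unavailable, since `Real.log 0 = 0`. The support inclusion
    -- makes the overlap vanish unless `r i = 0` too.
    rcases (hs0 j).eq_or_lt with h0 | h0
    · rcases (hr0 i).eq_or_lt with h1 | h1
      · simp [← h0, ← h1]
      · have := overlap_eq_zero_of_supp_le hMh hNh h h1.ne' h0.symm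
        simp [hO, this]
    · have hk := Real.pinsker_scalar (hr0 i) h0
      constructor
      · have : 0 < r i + 2 * s j := by linarith [hr0 i]
        have := nonneg_of_mul_nonneg_left (le_trans (by positivity) hk) this
        positivity
      · have := mul_le_mul_of_nonneg_left hk
          (show 0 ≤ 2 / 3 * (‖P j i‖ ^ 2 * ‖O i j‖ ^ 2) by positivity)
        rw [mul_pow, mul_pow, sq_abs]
        linarith
  -- The first factor sums to `2 / 3` of the entropy in nats, the second to `1 + 2 = 3`: together
  -- the Pinsker constant 2.
  have hCS := Finset.sum_sq_le_sum_mul_sum_of_sq_le_mul Finset.univ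
    (r := fun p : n × n => ‖P p.2 p.1‖ * |r p.1 - s p.2| * ‖O p.1 p.2‖)
    (f := fun p => 2 / 3 * (‖O p.1 p.2‖ ^ 2 *
      (r p.1 * (Real.log (r p.1) - Real.log (s p.2)) - r p.1 + s p.2)))
    (g := fun p => ‖P p.2 p.1‖ ^ 2 * (1 * r p.1 + 2 * s p.2))
    (fun p _ => mul_nonneg (by norm_num) (hterm p.1 p.2).1)
    (fun p _ => mul_nonneg (by positivity) (by linarith [hr0 p.1, hs0 p.2]))
    (fun p _ => (hterm p.1 p.2).2)
  have hg : ∑ p : n × n, ‖P p.2 p.1‖ ^ 2 * (1 * r p.1 + 2 * s p.2) = 3 := by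
    rw [Fintype.sum_prod_type, hsum (fun i j => ‖P j i‖ ^ 2) 1 2
      (fun i => sum_normSq_col_of_mul_conjTranspose hPu i)
      (fun j => sum_normSq_row_of_mul_conjTranspose hPu j)]
    norm_num
  rw [hg, ← Finset.mul_sum, Fintype.sum_prod_type
    (f := fun p : n × n => ‖O p.1 p.2‖ ^ 2 *
      (r p.1 * (Real.log (r p.1) - Real.log (s p.2)) - r p.1 + s p.2)), ← hD] at hCS
  have := pow_le_pow_left₀ (norm_nonneg _) hT 2
  linarith

/-- The trace norm of a Hermitian matrix is attained at a unitary. -/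
theorem exists_unitary_trace_mul_eq_traceNorm {M : Matrix n n ℂ} (hM : M.IsHermitian) :
    ∃ U : Matrix n n ℂ, U * Uᴴ = 1 ∧ (U * M).trace.re = traceNorm M := by
  have hc : ∀ (f : ℝ → ℝ), ContinuousOn f (spectrum ℝ M) := fun f =>
    M.finite_real_spectrum.continuousOn f
  -- The sign function with value 1 at 0, so that `g * g = 1` and `cfc g M` is unitary even when `M`
  -- is singular.
  set g : ℝ → ℝ := fun x => if 0 ≤ x then 1 else -1 with hg
  have hgg : (fun x : ℝ => g x * g x) = fun _ => (1 : ℝ) := by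
    funext x; simp only [hg]; split_ifs <;> norm_num
  have hsa : (cfc g M)ᴴ = cfc g M := (cfc_predicate g M : IsSelfAdjoint (cfc g M))
  refine ⟨cfc g M, ?_, ?_⟩
  · rw [hsa, ← cfc_mul g g M (hc _) (hc _), hgg, cfc_const_one ℝ M hM.isSelfAdjoint]
  · have e1 : cfc g M * M = cfc (fun x : ℝ => g x * x) M := by
      rw [cfc_mul g (fun x : ℝ => x) M (hc _) (hc _), cfc_id' ℝ M hM.isSelfAdjoint]
    rw [e1, traceNorm, cfc_sqrt_conjTranspose_mul_self hM]
    congr 2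
    congr 1
    funext x
    simp only [hg]
    split_ifs with h
    · rw [abs_of_nonneg h, one_mul]
    · rw [abs_of_neg (not_le.1 h), neg_one_mul]

theorem traceNorm_nonneg (M : Matrix n n ℂ) : 0 ≤ traceNorm M := by
  rw [traceNorm, trace_cfc (isHermitian_conjTranspose_mul_self M)]
  exact Finset.sum_nonneg fun i _ => Real.sqrt_nonneg _

/-- The trace norm dominates the Hilbert–Schmidt norm. -/
theorem sum_normSq_le_traceNorm_sq (M : Matrix n n ℂ) :
    ∑ i, ∑ j, ‖M i j‖ ^ 2 ≤ traceNorm M ^ 2 := by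
  have hH := isHermitian_conjTranspose_mul_self M
  have e : ∑ i, ∑ j, ‖M i j‖ ^ 2 = ∑ i, hH.eigenvalues i := by
    have h1 : ((∑ i, ∑ j, ‖M i j‖ ^ 2 : ℝ) : ℂ) = (Mᴴ * M).trace := by
      rw [Finset.sum_comm, trace]
      simp only [diag_apply, mul_apply, conjTranspose_apply, RCLike.star_def, Complex.conj_mul']
      push_cast
      rfl
    rw [← re_trace_eq_sum_eigenvalues, ← h1, Complex.ofReal_re]
  rw [e, traceNorm, trace_cfc hH]
  have h0 : ∀ i, 0 ≤ hH.eigenvalues i := (posSemidef_conjTranspose_mul_self M).eigenvalues_nonneg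
  calc _ = ∑ i, Real.sqrt (hH.eigenvalues i) ^ 2 :=
        Finset.sum_congr rfl fun i _ => (Real.sq_sqrt (h0 i)).symm
    _ ≤ _ := Finset.sum_sq_le_sq_sum_of_nonneg fun i _ => Real.sqrt_nonneg _

/-- Serves twice: it bounds the set of states, and it turns trace-norm convergence into entrywise
convergence. -/
theorem norm_apply_le_traceNorm (M : Matrix n n ℂ) (i j : n) : ‖M i j‖ ≤ traceNorm M := by
  refine abs_le_of_sq_le_sq' ?_ (traceNorm_nonneg M) |>.2
  refine le_trans ?_ (sum_normSq_le_traceNorm_sq M)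
  exact (Finset.single_le_sum (f := fun j => ‖M i j‖ ^ 2) (fun _ _ => by positivity)
    (Finset.mem_univ j)).trans (Finset.single_le_sum (f := fun i => ∑ j, ‖M i j‖ ^ 2)
      (fun _ _ => by positivity) (Finset.mem_univ i))

theorem traceNorm_eq_one_of_isState {M : Matrix n n ℂ} (hM : IsState M) : traceNorm M = 1 := by
  have hMh := hM.1.isHermitian
  rw [traceNorm, cfc_sqrt_conjTranspose_mul_self hMh, trace_cfc hMh, ← Complex.one_re, ← hM.2,
    re_trace_eq_sum_eigenvalues hMh]
  exact Finset.sum_congr rfl fun i _ => abs_of_nonneg (hM.1.eigenvalues_nonneg i)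

end Steering

/-! ### Compactness of convex hulls in finite dimension. -/

/-- Carathéodory's theorem with a fixed number of points. -/
theorem convexHull_eq_image_stdSimplex_prod {E : Type*} [AddCommGroup E] [Module ℝ E]
    [FiniteDimensional ℝ E] (s : Set E) :
    convexHull ℝ s = (fun p : (Fin (Module.finrank ℝ E + 1) → ℝ) ×
        (Fin (Module.finrank ℝ E + 1) → E) => ∑ i, p.1 i • p.2 i) ''
      (stdSimplex ℝ (Fin (Module.finrank ℝ E + 1)) ×ˢ Set.univ.pi fun _ => s) := by
  apply Set.Subset.antisymm
  · intro x hx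
    obtain ⟨x₀, hx₀⟩ : s.Nonempty := convexHull_nonempty_iff.1 ⟨x, hx⟩
    obtain ⟨ι, _, z, w, hz, hind, hw, hw1, hwz⟩ := eq_pos_convex_span_of_mem_convexHull hx
    obtain ⟨e⟩ : Nonempty (ι ↪ Fin (Module.finrank ℝ E + 1)) := by
      apply Function.Embedding.nonempty_of_card_le
      rw [Fintype.card_fin]
      exact hind.card_le_finrank_succ.trans
        (Nat.succ_le_succ (Submodule.finrank_le _))
    have hw0 : ∀ k ∉ Set.range e, Function.extend e w 0 k = 0 := fun k hk =>
      Function.extend_apply' _ _ _ hk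
    -- Unused slots get weight zero and the dummy point `x₀` of `s`.
    refine ⟨(Function.extend e w 0, Function.extend e z fun _ => x₀), ⟨⟨fun k => ?_, ?_⟩, ?_⟩, ?_⟩
    · by_cases hk : k ∈ Set.range e
      · obtain ⟨i, rfl⟩ := hk
        simpa [e.injective.extend_apply] using (hw i).le
      · exact (hw0 k hk).ge
    · rw [← hw1]
      exact (Fintype.sum_of_injective e e.injective _ _ hw0
        fun i => (e.injective.extend_apply _ _ _).symm).symm
    · intro k _
      by_cases hk : k ∈ Set.range e
      · obtain ⟨i, rfl⟩ := hk
        simpa [e.injective.extend_apply] using hz ⟨i, rfl⟩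
      · simpa [Function.extend_apply' _ _ _ hk] using hx₀
    · rw [← hwz]
      refine (Fintype.sum_of_injective e e.injective _ _ (fun k hk => ?_) fun i => ?_).symm
      · simp [hw0 k hk]
      · simp [e.injective.extend_apply]
  · rintro _ ⟨⟨w, z⟩, ⟨hw, hz⟩, rfl⟩
    exact (convex_convexHull ℝ s).sum_mem (fun i _ => hw.1 i) hw.2
      fun i _ => subset_convexHull ℝ s (hz i trivial)

theorem IsCompact.convexHull_of_finiteDimensional {E : Type*} [AddCommGroup E] [Module ℝ E]
    [FiniteDimensional ℝ E] [TopologicalSpace E] [ContinuousAdd E] [ContinuousSMul ℝ E]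
    {s : Set E} (hs : IsCompact s) : IsCompact (convexHull ℝ s) := by
  rw [convexHull_eq_image_stdSimplex_prod]
  refine ((isCompact_stdSimplex ℝ _).prod (isCompact_univ_pi fun _ => hs)).image ?_
  fun_prop

/-! ### Closedness of the local-hidden-state set. -/

namespace Steering

open Matrix

theorem isClosed_setOf_isState (n : Type*) [Fintype n] :
    IsClosed {M : Matrix n n ℂ | IsState M} := by
  have e : {M : Matrix n n ℂ | IsState M} = {M | Mᴴ = M} ∩
      (⋂ x : n → ℂ, {M | 0 ≤ star x ⬝ᵥ (M *ᵥ x)}) ∩ {M | M.trace = 1} := by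
    ext M
    simp only [IsState, posSemidef_iff_dotProduct_mulVec, IsHermitian, Set.mem_inter_iff,
      Set.mem_iInter, Set.mem_ofPred_eq]
  rw [e]
  refine ((isClosed_eq (by fun_prop) (by fun_prop)).inter (isClosed_iInter fun x => ?_)).inter
    (isClosed_eq (by fun_prop) (by fun_prop))
  exact isClosed_le continuous_const (by fun_prop)

theorem isCompact_setOf_isState (n : Type*) [Fintype n] [DecidableEq n] :
    IsCompact {M : Matrix n n ℂ | IsState M} := by
  have hK : IsCompact (Set.univ.pi fun _ : n => Set.univ.pi fun _ : n =>
      Metric.closedBall (0 : ℂ) 1) :=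
    isCompact_univ_pi fun _ => isCompact_univ_pi fun _ => isCompact_closedBall 0 1
  refine hK.of_isClosed_subset (isClosed_setOf_isState n) fun M hM i _ j _ => ?_
  rw [mem_closedBall_zero_iff, ← traceNorm_eq_one_of_isState hM]
  exact norm_apply_le_traceNorm M i j

/-- The families `(q(a|x) τ)` with a response function `q` and a state `τ`. -/
def responseFamilies (X A B : Type*) [Fintype A] [Fintype B] : Set (A → X → Matrix B B ℂ) :=
  (fun p : (X → A → ℝ) × Matrix B B ℂ => fun a x => p.1 x a • p.2) ''
    ((Set.univ.pi fun _ => stdSimplex ℝ A) ×ˢ {τ | IsState τ})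

theorem isCompact_responseFamilies (X A B : Type*) [Fintype A] [Fintype B] [DecidableEq B] :
    IsCompact (responseFamilies X A B) := by
  refine ((isCompact_univ_pi fun _ => isCompact_stdSimplex ℝ A).prod
    (isCompact_setOf_isState B)).image ?_
  fun_prop

/-- Assemblages with a local-hidden-state model are mixtures of response families. -/
theorem mem_LHS_iff {X A B : Type*} [Fintype X] [Fintype A] [Fintype B] (ρ : Assemblage X A B) :
    ρ ∈ LHS X A B ↔ ρ.op ∈ convexHull ℝ (responseFamilies X A B) := by
  constructor
  · rintro ⟨n, p, q, τ, hp, hq, hτ, h⟩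
    refine mem_convexHull_of_exists_fintype p (fun l a x => q l x a • τ l) hp.1 hp.2
      (fun l => ⟨(q l, τ l), ⟨fun x _ => hq l x, hτ l⟩, rfl⟩) ?_
    funext a x
    rw [h, Finset.sum_apply, Finset.sum_apply]
    refine Finset.sum_congr rfl fun l _ => ?_
    rw [Complex.coe_smul, mul_smul]
    rfl
  · intro h
    rw [convexHull_eq_image_stdSimplex_prod] at h
    obtain ⟨⟨w, z⟩, ⟨hw, hz⟩, hwz⟩ := h
    choose f hf hfz using fun l => hz l trivial
    refine ⟨_, w, fun l => (f l).1, fun l => (f l).2, hw, fun l x => (hf l).1 x trivial,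
      fun l => (hf l).2, fun a x => ?_⟩
    rw [← hwz]
    refine (congrFun (Finset.sum_apply a _ _) x).trans ((Finset.sum_apply x _ _).trans ?_)
    refine Finset.sum_congr rfl fun l _ => ?_
    rw [Complex.coe_smul, mul_smul, ← hfz]
    rfl

/-- An assemblage that is approximated in trace norm by assemblages with a local-hidden-state
model has such a model. -/
theorem mem_LHS_of_forall_exists_sum_traceNorm_lt {X A B : Type*} [Fintype X] [Fintype A]
    [Fintype B] [DecidableEq B] (ρ : Assemblage X A B)
    (h : ∀ ε > 0, ∃ σ ∈ LHS X A B, ∑ x, ∑ a, traceNorm (ρ.op a x - σ.op a x) < ε) :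
    ρ ∈ LHS X A B := by
  rw [mem_LHS_iff]
  have hK := (isCompact_responseFamilies X A B).convexHull_of_finiteDimensional
  choose σ hσ hlt using fun k : ℕ => h (1 / ((k : ℝ) + 1)) Nat.one_div_pos_of_nat
  refine hK.isClosed.mem_of_tendsto (f := fun k => (σ k).op) (b := Filter.atTop) ?_
    (Filter.Eventually.of_forall fun k => (mem_LHS_iff _).1 (hσ k))
  -- The topology on families of matrices is the product topology, so convergence is checked entry
  -- by entry.
  refine tendsto_pi_nhds.2 fun a => tendsto_pi_nhds.2 fun x => tendsto_pi_nhds.2 fun i =>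
    tendsto_pi_nhds.2 fun j => ?_
  rw [tendsto_iff_norm_sub_tendsto_zero]
  refine squeeze_zero (fun _ => norm_nonneg _) (fun k => ?_)
    tendsto_one_div_add_atTop_nhds_zero_nat
  refine le_trans ?_ (hlt k).le
  rw [norm_sub_rev]
  refine (norm_apply_le_traceNorm (ρ.op a x - (σ k).op a x) i j).trans ?_
  exact (Finset.single_le_sum (f := fun a => traceNorm (ρ.op a x - (σ k).op a x))
    (fun _ _ => traceNorm_nonneg _) (Finset.mem_univ a)).trans
    (Finset.single_le_sum (f := fun x => ∑ a, traceNorm (ρ.op a x - (σ k).op a x))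
      (fun _ _ => Finset.sum_nonneg fun _ _ => traceNorm_nonneg _) (Finset.mem_univ x))

end Steering

/-! ### The uniform operation and its output states. -/

namespace Steering

open Matrix

variable {X A B : Type*} [Fintype X] [DecidableEq X] [Fintype A] [DecidableEq A]
  [Fintype B]

theorem isCompletelyPositive_reindex {m n : Type*} (e : m ≃ n) :
    IsCompletelyPositive (reindexLinearEquiv ℂ ℂ e e : Matrix m m ℂ →ₗ[ℂ] Matrix n n ℂ) :=
  fun _ _ hM => hM.submatrix (Prod.map id e.symm)

/-- Bob does nothing, and Alice chooses her input uniformly at random. -/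
noncomputable def uniformLOCC (X B : Type*) [Fintype X] [Nonempty X] [Fintype B] :
    OneWayLOCC X B where
  cardY := 1
  -- Output systems are indexed by `Fin`, so the identity channel takes the form of a reindexing.
  dimB' := Fintype.card B
  p := fun _ _ => (Fintype.card X : ℝ)⁻¹
  p_mem := fun _ => ⟨fun _ => by positivity, by simp⟩
  K := fun _ => (reindexLinearEquiv ℂ ℂ (Fintype.equivFin B) (Fintype.equivFin B)).toLinearMap
  completelyPositive := fun _ => isCompletelyPositive_reindex _
  traceNonincreasing := fun _ M _ => (congrArg Complex.re
    (Equiv.sum_comp (Fintype.equivFin B).symm fun i => M i i)).le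
  tracePreserving := fun M => by
    rw [Fin.sum_univ_one]
    exact Equiv.sum_comp (Fintype.equivFin B).symm fun i => M i i

theorem outputState_apply (L : OneWayLOCC X B) (ρ : Assemblage X A B) (x x' : X) (a a' : A)
    (i i' : Fin L.dimB') (y y' : Fin L.cardY) :
    L.outputState ρ (x, a, i, y) (x', a', i', y') =
      if y = y' then if (x, a) = (x', a') then (L.p y x : ℂ) * L.K y (ρ.op a x) i i' else 0
        else 0 := by
  rw [OneWayLOCC.outputState]
  simp only [Matrix.sum_apply, Matrix.smul_apply, kroneckerMap_apply, single_apply,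
    Prod.mk.injEq]
  rw [Finset.sum_eq_single x, Finset.sum_eq_single a, Finset.sum_eq_single y]
  · by_cases hx : x = x' <;> by_cases ha : a = a' <;> by_cases hy : y = y' <;> simp [hx, ha, hy]
  · intro b _ hb; simp [hb]
  · simp
  · intro b _ hb; simp [hb]
  · simp
  · intro b _ hb; simp [hb]
  · simp

/-- The index set of the output of `uniformLOCC`, as pairs of an index of `B` and a label. -/
noncomputable def uniformOutputEquiv (X A B : Type*) [Fintype X] [Nonempty X] [Fintype B] :
    X × A × Fin (uniformLOCC X B).dimB' × Fin (uniformLOCC X B).cardY ≃ B × (X × A) where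
  toFun p := ((Fintype.equivFin B).symm p.2.2.1, (p.1, p.2.1))
  invFun p := (p.2.1, p.2.2, Fintype.equivFin B p.1, (0 : Fin 1))
  left_inv := fun ⟨x, a, i, y⟩ => by
    obtain rfl : y = (0 : Fin 1) := Subsingleton.elim (α := Fin 1) _ _
    exact congrArg (fun j => (x, a, j, (0 : Fin 1))) ((Fintype.equivFin B).apply_symm_apply i)
  right_inv p := by simp

theorem outputState_uniformLOCC [Nonempty X] (ρ : Assemblage X A B) :
    (uniformLOCC X B).outputState ρ =
      (blockDiagonal fun q : X × A => ((Fintype.card X : ℂ)⁻¹) • ρ.op q.2 q.1).submatrix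
        (uniformOutputEquiv X A B) (uniformOutputEquiv X A B) := by
  ext ⟨x, a, i, y⟩ ⟨x', a', i', y'⟩
  obtain rfl : y = y' := Subsingleton.elim (α := Fin 1) _ _
  rw [outputState_apply, if_pos rfl]
  refine Eq.trans ?_ (blockDiagonal_apply (fun q : X × A => ((Fintype.card X : ℂ)⁻¹) • ρ.op q.2 q.1)
    ((Fintype.equivFin B).symm i, (x, a)) ((Fintype.equivFin B).symm i', (x', a'))).symm
  refine if_congr Iff.rfl ?_ rfl
  have : (((Fintype.card X : ℝ)⁻¹ : ℝ) : ℂ) = (Fintype.card X : ℂ)⁻¹ := by push_cast; rfl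
  exact congrArg (· * _) this

-- Each block factors as `(N k)ᴴ * N k`, hence so does the block-diagonal matrix.
open scoped MatrixOrder Matrix.Norms.L2Operator in
theorem posSemidef_blockDiagonal {m o : Type*} [Fintype m] [DecidableEq m] [Fintype o]
    [DecidableEq o] {M : o → Matrix m m ℂ} (h : ∀ k, (M k).PosSemidef) :
    (blockDiagonal M).PosSemidef := by
  choose N hN using fun k => CStarAlgebra.nonneg_iff_eq_star_mul_self.1 (h k).nonneg
  obtain rfl : M = fun k => (N k)ᴴ * N k := funext hN
  rw [blockDiagonal_mul, ← blockDiagonal_conjTranspose]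
  exact posSemidef_conjTranspose_mul_self _

theorem isState_outputState_uniformLOCC [Nonempty X] [DecidableEq B] (ρ : Assemblage X A B) :
    IsState ((uniformLOCC X B).outputState ρ) := by
  rw [outputState_uniformLOCC]
  constructor
  · have h : ∀ q : X × A, ((Fintype.card X : ℂ)⁻¹ • ρ.op q.2 q.1).PosSemidef := fun q =>
      (ρ.posSemidef q.2 q.1).smul (by positivity)
    exact (posSemidef_blockDiagonal h).submatrix _
  · have h : ∀ x, ∑ a, (ρ.op a x).trace = 1 := fun x => by
      rw [← trace_sum, (ρ.isState x).2]
    have e : ∀ M : Matrix (B × X × A) (B × X × A) ℂ,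
      (M.submatrix (uniformOutputEquiv X A B) (uniformOutputEquiv X A B)).trace = M.trace :=
      fun M => Equiv.sum_comp (uniformOutputEquiv X A B) fun i => M i i
    rw [e, trace_blockDiagonal, Fintype.sum_prod_type]
    simp [← Finset.mul_sum, h]

/-- The quantum Pinsker inequality for the output states of `uniformLOCC`. -/
theorem sq_sum_traceNorm_le [Nonempty X] [DecidableEq B] (ρ σ : Assemblage X A B)
    (h : supp ((uniformLOCC X B).outputState ρ) ≤ supp ((uniformLOCC X B).outputState σ)) :
    (1 / (Fintype.card X : ℝ) * ∑ x, ∑ a, traceNorm (ρ.op a x - σ.op a x)) ^ 2 ≤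
      2 * Real.log 2 * ((uniformLOCC X B).outputState ρ *
        (log2 ((uniformLOCC X B).outputState ρ) -
          log2 ((uniformLOCC X B).outputState σ))).trace.re := by
  -- The optimal unitaries of the blocks assemble into one block-diagonal unitary testing all
  -- differences at once.
  choose U hU hUt using fun q : X × A => exists_unitary_trace_mul_eq_traceNorm
    ((ρ.posSemidef q.2 q.1).isHermitian.sub (σ.posSemidef q.2 q.1).isHermitian)
  set e := uniformOutputEquiv X A B
  have hV : (blockDiagonal U).submatrix e e * ((blockDiagonal U).submatrix e e)ᴴ = 1 := by
    rw [conjTranspose_submatrix, submatrix_mul_equiv, blockDiagonal_conjTranspose,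
      ← blockDiagonal_mul]
    simp only [hU]
    change (blockDiagonal (1 : X × A → Matrix B B ℂ)).submatrix e e = 1
    rw [blockDiagonal_one, submatrix_one_equiv]
  refine le_trans ?_ (sq_norm_trace_mul_sub_le (isState_outputState_uniformLOCC ρ)
    (isState_outputState_uniformLOCC σ) h hV)
  refine (sq_le_sq₀ (mul_nonneg (by positivity) (Finset.sum_nonneg fun x _ =>
    Finset.sum_nonneg fun a _ => traceNorm_nonneg _)) (norm_nonneg _)).2 ?_
  refine le_trans (le_of_eq ?_) (Complex.re_le_norm _)
  have etr : ∀ M : Matrix (B × X × A) (B × X × A) ℂ,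
      (M.submatrix e e).trace = M.trace := fun M => Equiv.sum_comp e fun i => M i i
  rw [outputState_uniformLOCC, outputState_uniformLOCC]
  have hsub : ∀ M N : Matrix (B × X × A) (B × X × A) ℂ,
      M.submatrix e e - N.submatrix e e = (M - N).submatrix e e := fun _ _ => rfl
  rw [hsub, submatrix_mul_equiv, etr, ← blockDiagonal_sub, ← blockDiagonal_mul,
    trace_blockDiagonal, Fintype.sum_prod_type, Complex.re_sum, Finset.mul_sum]
  refine Finset.sum_congr rfl fun x _ => ?_
  rw [Complex.re_sum, Finset.mul_sum]
  refine Finset.sum_congr rfl fun a _ => ?_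
  rw [Pi.sub_apply, ← smul_sub, Matrix.mul_smul, trace_smul, smul_eq_mul, ← hUt (x, a), one_div,
    ← Complex.re_ofReal_mul]
  push_cast
  rfl

end Steering

/-! ### From Pinsker to the steering bound and faithfulness. -/

namespace Steering

theorem le_relEntropy_outputState_uniformLOCC {X A B : Type*} [Fintype X] [DecidableEq X]
    [Nonempty X] [Fintype A] [DecidableEq A] [Fintype B] [DecidableEq B]
    (ρ σ : Assemblage X A B) :
    (((1 / (Fintype.card X : ℝ) * ∑ x, ∑ a, traceNorm (ρ.op a x - σ.op a x)) ^ 2 /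
      (2 * Real.log 2) : ℝ) : EReal) ≤
      relEntropy ((uniformLOCC X B).outputState ρ) ((uniformLOCC X B).outputState σ) := by
  have hl : 0 < Real.log 2 := Real.log_pos one_lt_two
  rw [relEntropy]
  split_ifs with h
  · rw [EReal.coe_le_coe_iff, div_le_iff₀' (by positivity)]
    exact sq_sum_traceNorm_le ρ σ h
  · exact le_top

end Steering

theorem mainTheorem4 {X A B : Type*} [Fintype X] [DecidableEq X] [Nonempty X]
    [Fintype A] [DecidableEq A] [Fintype B] [DecidableEq B]
    (ρ : Steering.Assemblage X A B) :
    0 ≤ Steering.relEntropySteering ρ ∧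
    (⨅ σ ∈ Steering.LHS X A B, ENNReal.ofReal
        (1 / (Fintype.card X : ℝ) * ∑ x, ∑ a, Steering.traceNorm (ρ.op a x - σ.op a x))) ≤
      (ENNReal.ofReal (2 * Real.log 2) * (Steering.relEntropySteering ρ).toENNReal)
        ^ (1 / 2 : ℝ) ∧
    (Steering.relEntropySteering ρ = 0 → ρ ∈ Steering.LHS X A B) := by
  have hl : 0 < 2 * Real.log 2 := mul_pos two_pos (Real.log_pos one_lt_two)
  have hcard : (0 : ℝ) < Fintype.card X := Nat.cast_pos.2 Fintype.card_pos
  have hT0 : ∀ σ : Steering.Assemblage X A B, 0 ≤ 1 / (Fintype.card X : ℝ) *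
      ∑ x, ∑ a, Steering.traceNorm (ρ.op a x - σ.op a x) := fun σ =>
    mul_nonneg (by positivity) (Finset.sum_nonneg fun x _ => Finset.sum_nonneg fun a _ =>
      Steering.traceNorm_nonneg _)
  have hR : (⨅ σ ∈ Steering.LHS X A B, Steering.relEntropy
      ((Steering.uniformLOCC X B).outputState ρ) ((Steering.uniformLOCC X B).outputState σ)) ≤
      Steering.relEntropySteering ρ :=
    le_iSup (fun L : Steering.OneWayLOCC X B => ⨅ σ ∈ Steering.LHS X A B,
      Steering.relEntropy (L.outputState ρ) (L.outputState σ)) (Steering.uniformLOCC X B)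
  have key : (⨅ σ ∈ Steering.LHS X A B, ENNReal.ofReal
        (1 / (Fintype.card X : ℝ) * ∑ x, ∑ a, Steering.traceNorm (ρ.op a x - σ.op a x))) ≤
      (ENNReal.ofReal (2 * Real.log 2) * (Steering.relEntropySteering ρ).toENNReal)
        ^ (1 / 2 : ℝ) := by
    set t := ⨅ σ ∈ Steering.LHS X A B, ENNReal.ofReal
        (1 / (Fintype.card X : ℝ) * ∑ x, ∑ a, Steering.traceNorm (ρ.op a x - σ.op a x)) with ht
    have h1 : ((t ^ 2 / ENNReal.ofReal (2 * Real.log 2) : ℝ≥0∞) : EReal) ≤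
        Steering.relEntropySteering ρ := by
      refine le_trans (le_iInf₂ fun σ hσ => ?_) hR
      refine le_trans ?_ (Steering.le_relEntropy_outputState_uniformLOCC ρ σ)
      rw [← max_eq_left (div_nonneg (sq_nonneg (1 / (Fintype.card X : ℝ) *
        ∑ x, ∑ a, Steering.traceNorm (ρ.op a x - σ.op a x))) hl.le), ← EReal.coe_ennreal_ofReal,
        EReal.coe_ennreal_le_coe_ennreal_iff, ENNReal.ofReal_div_of_pos hl,
        ENNReal.ofReal_pow (hT0 σ)]
      gcongr
      exact iInf₂_le σ hσ
    have h2 : t ^ 2 / ENNReal.ofReal (2 * Real.log 2) ≤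
        (Steering.relEntropySteering ρ).toENNReal := by
      simpa using EReal.toENNReal_le_toENNReal h1
    rw [ENNReal.div_le_iff_le_mul (Or.inl (ENNReal.ofReal_pos.2 hl).ne')
      (Or.inl ENNReal.ofReal_ne_top), mul_comm] at h2
    rw [one_div, ENNReal.le_rpow_inv_iff two_pos]
    exact_mod_cast h2
  -- Nonnegativity matters because `toENNReal` sends negative values to 0: it ensures that `key`
  -- involves the true entropy.
  refine ⟨?_, key, fun h0 => ?_⟩
  · refine le_trans (le_iInf₂ fun σ _ => ?_) hR
    refine le_trans ?_ (Steering.le_relEntropy_outputState_uniformLOCC ρ σ)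
    exact EReal.coe_nonneg.2 (div_nonneg (sq_nonneg _) hl.le)
  · rw [h0, EReal.toENNReal_zero, mul_zero, ENNReal.zero_rpow_of_pos (by norm_num)] at key
    refine Steering.mem_LHS_of_forall_exists_sum_traceNorm_lt ρ fun ε hε => ?_
    -- The threshold `ε / |X|` absorbs the average over inputs.
    have hlt := lt_of_le_of_lt key (ENNReal.ofReal_pos.2 (div_pos hε hcard))
    obtain ⟨σ, hσ⟩ := iInf_lt_iff.1 hlt
    obtain ⟨hmem, hσ⟩ := iInf_lt_iff.1 hσ
    refine ⟨σ, hmem, ?_⟩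
    rw [ENNReal.ofReal_lt_ofReal_iff_of_nonneg (hT0 σ), one_div, inv_mul_eq_div,
      div_lt_div_iff_of_pos_right hcard] at hσ
    exact hσ
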